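/- Let $\ell \ge 0$ and let $q_1,\dots,q_\ell > 2$ be pairwise coprime natural numbers. Write $\zeta_n$ for a primitive $n$-th root of unity in $\mathbb{C}$ and $\varphi$ for Euler's totient function. (i) For $1\le j\le \ell$ let $T_j=\{a\in\mathbb{N} : 1\le a<q_j/2,\ \gcd(a,q_j)=1\}$. Then the real numbers $\cot(\pi a/q_j)$, indexed by all pairs $(j,a)$ with $1\le j\le \ell$ and $a\in T_j$, are linearly independent over $\mathbb{Q}$. (ii) Let $K\subset\mathbb{C}$ be a number field such that $$K(\zeta_{\varphi(q_1)\cdots\varphi(q_\ell)})\cap \mathbb{Q}(\zeta_{q_1\cdots q_\ell})=\mathbb{Q}.$$ Then the numbers $L(1,\chi)$, indexed by all pairs $(j,\chi)$ with $1\le j\le\ell$ and $\chi$ a Dirichlet character modulo $q_j$ (not necessarily primitive) with $\chi(-1)=-1$, are linearly independent over $K(\zeta_{\varphi(q_1)\cdots\varphi(q_\ell)})$. Here $L(s,\chi)$ is the entire continuation of $\sum_{n\ge1}\chi(n)n^{-s}$. In both parts, linear independence is that of the indexed family; in particular the numbers with different indices are distinct. -/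

import Mathlib

/-! For odd `χ` mod `q`, `L(1, χ)` is `iπ/(2q)` times `S(χ) = ∑ χ(x) cotChar(x)`, and `cotChar(x) =
-i cot(πx/q)` is a rational expression in roots of unity. After the common transcendental factor is
removed, a linear relation lives in `F(ξ)`, with `ξ` of order `N = ∏ q_j`. As `F ∩ ℚ(ξ) = ℚ`, every
`ξ ↦ ξ^b` with `b` prime to `N` extends to an `F`-embedding; by the Chinese remainder theorem the
arguments mod each `q_j` can be multiplied by independent units `u_j`
(`ZMod.sum_mul_cotChar_smul_eq_zero`).

In (ii), `F` contains the values of `χ`, so a twist multiplies `S(χ)` by `χ(u_j)⁻¹`. Dedekind's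
independence of characters of `∏ (ℤ/q_j)ˣ` and `S(χ) ≠ 0`, that is `L(1, χ) ≠ 0`, finish. In (i), `F
= ℚ`: twisting isolates one modulus, and character orthogonality with `S(χ) ≠ 0` isolates each
coefficient. -/

/-! ### Cotangent formula for `L(1, χ)`, `χ` odd -/

open Filter Topology in
lemma Complex.hasSum_one_div_add_sub_one_div_sub {a : ℝ} (ha : a ∈ Set.Ioo (0 : ℝ) 1)
    (hs : Summable fun n : ℕ => (1 / (n + a : ℂ) - 1 / (n + 1 - a : ℂ))) :
    HasSum (fun n : ℕ => (1 / (n + a : ℂ) - 1 / (n + 1 - a : ℂ)))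
      (Real.pi * Complex.cot (Real.pi * a)) := by
  have hz : (a : ℂ) ∈ Complex.integerComplement := by
    rintro ⟨n, hn⟩
    have hn' : (n : ℝ) = a := by exact_mod_cast hn
    have h0 : (0 : ℝ) < n := hn' ▸ ha.1
    have h1 : (n : ℝ) < 1 := hn' ▸ ha.2
    norm_cast at h0 h1
    omega
  rw [hs.hasSum_iff_tendsto_nat]
  have h1 := tendsto_logDeriv_euler_cot_sub hz
  have h2 : Tendsto (fun n : ℕ => 1 / ((a : ℂ) + n)) atTop (𝓝 0) := by
    have := (tendsto_const_nhds (x := (1 : ℝ))).div_atTop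
      (tendsto_atTop_add_const_left atTop a (tendsto_natCast_atTop_atTop (R := ℝ)))
    have := (Complex.continuous_ofReal.tendsto 0).comp this
    refine (this.congr fun n => ?_)
    simp
  -- Euler's expansion pairs the poles `k` and `-k`; pairing `-n` with `n + 1` instead changes
  -- partial sums by the vanishing term `1/(a + n)`.
  have h3 := (h1.add_const (1 / (a : ℂ))).sub h2
  rw [sub_add_cancel, sub_zero] at h3
  refine h3.congr fun n => ?_
  induction n with
  | zero => simp
  | succ n ih =>
    rw [Finset.sum_range_succ, Finset.sum_range_succ, ← ih, cotTerm]
    have : (n + 1 - a : ℂ) = - (a - (n + 1)) := by ring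
    rw [this, div_neg]
    push_cast
    ring

/-- Uniformity in `s` gives the dominating series for `s → 1⁺`. For `x ≤ y` the difference is
`x^(-s) (1 - (x/y)^s)`, and both factors are `O(1/n)`, the second because `1 - r^s ≤ 1 - r² ≤ 2(1 -
r)` for `0 < r ≤ 1`. -/
lemma Real.abs_rpow_neg_sub_rpow_neg_le {c x y s : ℝ} {n : ℕ} (hc : 0 < c)
    (hx : c * (n + 1) ≤ x) (hy : c * (n + 1) ≤ y) (hxy : |x - y| ≤ 1) (hc1 : c ≤ 1)
    (hs : s ∈ Set.Icc (1 : ℝ) 2) :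
    |x ^ (-s) - y ^ (-s)| ≤ 2 * c⁻¹ ^ 3 * (1 / ((n : ℝ) + 1) ^ 2) := by
  wlog h : x ≤ y generalizing x y
  · rw [abs_sub_comm]
    exact this hy hx (by rwa [abs_sub_comm]) (le_of_not_ge h)
  have hn : (1 : ℝ) ≤ n + 1 := by linarith [n.cast_nonneg (α := ℝ)]
  have hm : 0 < c * (n + 1) := by positivity
  have hx0 : 0 < x := hm.trans_le hx
  have hy0 : 0 < y := hm.trans_le hy
  have hxs : x ^ (-s) ≤ c⁻¹ ^ 2 * (n + 1 : ℝ)⁻¹ := by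
    calc x ^ (-s) ≤ (c * (n + 1)) ^ (-s) :=
          Real.rpow_le_rpow_of_nonpos hm hx (by linarith [hs.1])
      _ = c ^ (-s) * (n + 1 : ℝ) ^ (-s) := Real.mul_rpow hc.le (by positivity)
      _ ≤ c ^ (-2 : ℝ) * (n + 1 : ℝ) ^ (-1 : ℝ) := by
          gcongr ?_ * ?_
          · exact Real.rpow_le_rpow_of_exponent_ge hc hc1 (by linarith [hs.2])
          · exact Real.rpow_le_rpow_of_exponent_le hn (by linarith [hs.1])
      _ = _ := by
          rw [Real.rpow_neg_one, Real.rpow_neg hc.le, inv_pow]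
          norm_num
  have hr : x / y ≤ 1 := (div_le_one hy0).2 h
  have hr0 : 0 < x / y := by positivity
  have hfac : x ^ (-s) - y ^ (-s) = x ^ (-s) * (1 - (x / y) ^ s) := by
    rw [Real.div_rpow hx0.le hy0.le, Real.rpow_neg hx0.le, Real.rpow_neg hy0.le]
    have := Real.rpow_pos_of_pos hx0 s
    have := Real.rpow_pos_of_pos hy0 s
    field_simp
  have h2 : (x / y) ^ 2 ≤ (x / y) ^ s := by
    rw [← Real.rpow_two]
    exact Real.rpow_le_rpow_of_exponent_ge hr0 hr hs.2
  have h1 : (x / y) ^ s ≤ 1 := Real.rpow_le_one hr0.le hr (by linarith [hs.1])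
  have h3 : 1 - (x / y) ^ s ≤ 2 * (c⁻¹ * (n + 1 : ℝ)⁻¹) := by
    have : 1 - x / y ≤ c⁻¹ * (n + 1 : ℝ)⁻¹ := by
      rw [← mul_inv, one_sub_div hy0.ne', div_eq_mul_inv]
      have hyx : y - x ≤ 1 := by rw [abs_sub_comm] at hxy; exact (le_abs_self _).trans hxy
      calc (y - x) * y⁻¹ ≤ 1 * y⁻¹ := by gcongr
        _ ≤ _ := by rw [one_mul]; gcongr
    nlinarith
  rw [hfac, abs_of_nonneg (mul_nonneg (by positivity) (by linarith))]
  calc x ^ (-s) * (1 - (x / y) ^ s)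
      ≤ (c⁻¹ ^ 2 * (n + 1 : ℝ)⁻¹) * (2 * (c⁻¹ * (n + 1 : ℝ)⁻¹)) :=
        mul_le_mul hxs h3 (by linarith) (by positivity)
    _ = _ := by field_simp

open Filter Topology HurwitzZeta in
-- The series represents the function for `s > 1`; dominated convergence and continuity carry the
-- identity to `s = 1`.
lemma HurwitzZeta.hurwitzZetaOdd_one {a : ℝ} (ha : a ∈ Set.Ioo (0 : ℝ) 1) :
    hurwitzZetaOdd a 1 = Real.pi / 2 * Complex.cot (Real.pi * a) := by
  set c := min a (1 - a) with hc
  have hc0 : 0 < c := lt_min ha.1 (by linarith [ha.2])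
  have hca : c ≤ a := min_le_left _ _
  have hcb : c ≤ 1 - a := min_le_right _ _
  have hc1 : c ≤ 1 := hca.trans ha.2.le
  let g (s : ℝ) (n : ℕ) : ℝ := (n + a) ^ (-s) - (n + 1 - a) ^ (-s)
  have hn0 (n : ℕ) : (0 : ℝ) ≤ n := n.cast_nonneg
  have hx (n : ℕ) : c * (n + 1) ≤ n + a := by nlinarith [hn0 n]
  have hy (n : ℕ) : c * (n + 1) ≤ n + 1 - a := by nlinarith [hn0 n]
  have hx0 (n : ℕ) : (0 : ℝ) < n + a := by linarith [hn0 n, ha.1]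
  have hy0 (n : ℕ) : (0 : ℝ) < n + 1 - a := by linarith [hn0 n, ha.2]
  have hbound {s : ℝ} (hs : s ∈ Set.Icc (1 : ℝ) 2) (n : ℕ) :
      ‖g s n‖ ≤ 2 * c⁻¹ ^ 3 * (1 / ((n : ℝ) + 1) ^ 2) := by
    refine Real.abs_rpow_neg_sub_rpow_neg_le hc0 (hx n) (hy n) ?_ hc1 hs
    rw [abs_le]
    constructor <;> linarith [ha.1, ha.2]
  have hsum : Summable fun n : ℕ => 2 * c⁻¹ ^ 3 * (1 / ((n : ℝ) + 1) ^ 2) := by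
    refine Summable.mul_left _ ?_
    have := (summable_nat_add_iff 1).2 (Real.summable_one_div_nat_pow.2 (one_lt_two))
    simpa using this
  have hcast (s : ℝ) (n : ℕ) : ((g s n : ℝ) : ℂ) =
      1 / (n + a : ℂ) ^ (s : ℂ) - 1 / (n + 1 - a : ℂ) ^ (s : ℂ) := by
    simp only [g]
    rw [Complex.ofReal_sub, Real.rpow_neg (hx0 n).le, Real.rpow_neg (hy0 n).le,
      Complex.ofReal_inv, Complex.ofReal_inv, Complex.ofReal_cpow (hx0 n).le,
      Complex.ofReal_cpow (hy0 n).le]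
    push_cast
    simp only [one_div]
  have hlim : Tendsto (fun s : ℝ => ∑' n, g s n) (𝓝[>] 1) (𝓝 (∑' n, g 1 n)) := by
    refine tendsto_tsum_of_dominated_convergence hsum (fun n => ?_) ?_
    · have : Continuous fun s => g s n :=
        (continuous_const.rpow continuous_neg fun _ => Or.inl (hx0 n).ne').sub
          (continuous_const.rpow continuous_neg fun _ => Or.inl (hy0 n).ne')
      exact (this.tendsto 1).mono_left nhdsWithin_le_nhds
    · filter_upwards [Ioo_mem_nhdsGT (one_lt_two (α := ℝ))] with s hs n
      exact hbound ⟨hs.1.le, hs.2.le⟩ n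
  have hval {s : ℝ} (hs : 1 < s) : ((∑' n, g s n : ℝ) : ℂ) / 2 = hurwitzZetaOdd a s := by
    have := hasSum_nat_hurwitzZetaOdd_of_mem_Icc ⟨ha.1.le, ha.2.le⟩ (s := (s : ℂ)) (by simpa)
    rw [← this.tsum_eq, Complex.ofReal_tsum, ← tsum_div_const]
    exact tsum_congr fun n => by rw [hcast]
  have hlim1 : Tendsto (fun s : ℝ => hurwitzZetaOdd a (s : ℂ)) (𝓝[>] 1)
      (𝓝 (hurwitzZetaOdd a 1)) := by
    have : Continuous fun s : ℝ => hurwitzZetaOdd a (s : ℂ) :=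
      (differentiable_hurwitzZetaOdd a).continuous.comp Complex.continuous_ofReal
    simpa using (this.tendsto 1).mono_left nhdsWithin_le_nhds
  have hlim2 : Tendsto (fun s : ℝ => hurwitzZetaOdd a (s : ℂ)) (𝓝[>] 1)
      (𝓝 (((∑' n, g 1 n : ℝ) : ℂ) / 2)) := by
    refine (((Complex.continuous_ofReal.tendsto _).comp hlim).div_const 2).congr' ?_
    filter_upwards [self_mem_nhdsWithin] with s hs using hval hs
  have hS : Summable (fun n => g 1 n) :=
    Summable.of_norm_bounded hsum fun n => hbound ⟨le_rfl, one_le_two⟩ n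
  have hS' : Summable fun n : ℕ => (1 / (n + a : ℂ) - 1 / (n + 1 - a : ℂ)) := by
    refine (Complex.summable_ofReal.2 hS).congr fun n => ?_
    rw [hcast]
    simp
  rw [tendsto_nhds_unique hlim1 hlim2, Complex.ofReal_tsum]
  have := (Complex.hasSum_one_div_add_sub_one_div_sub ha hS').tsum_eq
  rw [div_mul_eq_mul_div, ← this]
  congr 1
  refine tsum_congr fun n => ?_
  rw [hcast]
  simp

/-- `x ↦ (e(x) + 1) / (e(x) - 1) = -i cot (π x / N)`, where `e(x) = exp (2π i x / N)`. -/
noncomputable def ZMod.cotChar {N : ℕ} [NeZero N] (x : ZMod N) : ℂ :=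
  (ZMod.stdAddChar x + 1) / (ZMod.stdAddChar x - 1)

lemma ZMod.cotChar_natCast {N : ℕ} [NeZero N] (a : ℕ) :
    ZMod.cotChar (a : ZMod N) = -Complex.I * Complex.cot (Real.pi * (a / N : ℝ)) := by
  have h : ZMod.stdAddChar (a : ZMod N) = Complex.exp (2 * Real.pi * Complex.I * (a / N : ℝ)) := by
    have := ZMod.stdAddChar_coe (N := N) a
    push_cast at this
    rw [this]
    push_cast
    ring_nf
  rw [ZMod.cotChar, h, Complex.cot_pi_eq_exp_ratio]
  generalize Complex.exp (2 * Real.pi * Complex.I * (a / N : ℝ)) = e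
  rw [← neg_sub 1 e, div_neg, ← mul_div_assoc, neg_mul, neg_div, mul_div_mul_left _ _ Complex.I_ne_zero]

lemma ZMod.cotChar_neg {N : ℕ} [NeZero N] (x : ZMod N) : cotChar (-x) = -cotChar x := by
  have h : ZMod.stdAddChar x ≠ 0 := by
    intro h
    have := AddChar.map_add_eq_mul (ZMod.stdAddChar (N := N)) x (-x)
    rw [h, add_neg_cancel, AddChar.map_zero_eq_one, zero_mul] at this
    exact one_ne_zero this
  rw [cotChar, cotChar, AddChar.map_neg_eq_inv, ← div_neg, neg_sub,
    ← mul_div_mul_left (_ + 1) (_ - 1) h, mul_add, mul_sub, mul_inv_cancel₀ h, mul_one, add_comm]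

lemma HurwitzZeta.hurwitzZetaOdd_toAddCircle_one {N : ℕ} [NeZero N] {x : ZMod N} (hx : x ≠ 0) :
    hurwitzZetaOdd (ZMod.toAddCircle x) 1 = Complex.I * (Real.pi / 2) * ZMod.cotChar x := by
  have hN : (0 : ℝ) < N := by exact_mod_cast Nat.pos_of_ne_zero (NeZero.ne N)
  have h := hurwitzZetaOdd_one (a := (x.val / N : ℝ))
    ⟨by have := (ZMod.val_pos).2 hx; positivity,
      (div_lt_one hN).2 (by exact_mod_cast ZMod.val_lt x)⟩
  have hv := ZMod.cotChar_natCast (N := N) x.val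
  rw [ZMod.natCast_zmod_val] at hv
  rw [ZMod.toAddCircle_apply, h, hv]
  linear_combination (Real.pi / 2 * Complex.cot (Real.pi * (x.val / N : ℝ))) * Complex.I_mul_I

lemma DirichletCharacter.Odd.map_zero {N : ℕ} {χ : DirichletCharacter ℂ N} (hχ : χ.Odd) :
    χ 0 = 0 := by
  have h : χ (-1) = -1 := hχ
  by_contra h0
  have hu : IsUnit (0 : ZMod N) := by
    by_contra hu
    exact h0 (χ.map_nonunit hu)
  have := isUnit_zero_iff.1 hu
  have h1 : (-1 : ZMod N) = 1 := by
    rw [← mul_one (-1 : ZMod N), ← this, mul_zero]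
  rw [h1, map_one] at h
  norm_num at h

lemma DirichletCharacter.Odd.LFunction_one {N : ℕ} [NeZero N] {χ : DirichletCharacter ℂ N}
    (hχ : χ.Odd) : χ.LFunction 1 =
      Complex.I * Real.pi / (2 * N) * ∑ x : ZMod N, χ x * ZMod.cotChar x := by
  rw [DirichletCharacter.LFunction, ZMod.LFunction_def_odd hχ.to_fun]
  rw [Complex.cpow_neg_one]
  have : ∑ x : ZMod N, χ x * HurwitzZeta.hurwitzZetaOdd (ZMod.toAddCircle x) 1 =
      ∑ x : ZMod N, χ x * (Complex.I * (Real.pi / 2) * ZMod.cotChar x) := by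
    refine Finset.sum_congr rfl fun x _ => ?_
    rcases eq_or_ne x 0 with rfl | hx
    · rw [hχ.map_zero, zero_mul, zero_mul]
    · rw [HurwitzZeta.hurwitzZetaOdd_toAddCircle_one hx]
  rw [this, Finset.mul_sum, Finset.mul_sum]
  refine Finset.sum_congr rfl fun x _ => ?_
  have : (N : ℂ) ≠ 0 := NeZero.ne _
  field_simp

lemma DirichletCharacter.Odd.sum_mul_cotChar_ne_zero {N : ℕ} [NeZero N]
    {χ : DirichletCharacter ℂ N} (hχ : χ.Odd) : ∑ x : ZMod N, χ x * ZMod.cotChar x ≠ 0 := by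
  have h1 : χ ≠ 1 := by
    rintro rfl
    have : (1 : DirichletCharacter ℂ N) (-1) = -1 := hχ
    rw [MulChar.one_apply isUnit_one.neg] at this
    norm_num at this
  intro h
  exact DirichletCharacter.LFunction_apply_one_ne_zero h1 (by rw [hχ.LFunction_one, h, mul_zero])


/-! ### Galois action on cotangent relations -/

open IntermediateField in
-- Since `ℚ(ξ)/ℚ` is Galois, trivial intersection gives linear disjointness: the first `φ(N)` powers
-- of `ξ` stay independent over `F`.
lemma IsPrimitiveRoot.minpoly_eq_cyclotomic_of_inf_eq_bot (F : IntermediateField ℚ ℂ)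
    [FiniteDimensional ℚ F] {N : ℕ} [NeZero N] {ξ : ℂ} (hξ : IsPrimitiveRoot ξ N)
    (h : F ⊓ ℚ⟮ξ⟯ = ⊥) : minpoly F ξ = Polynomial.cyclotomic N F := by
  have hint : IsIntegral ℚ ξ := (hξ.isIntegral (NeZero.pos N)).tower_top
  have hintF : IsIntegral F ξ := hint.tower_top
  have : FiniteDimensional ℚ ℚ⟮ξ⟯ := adjoin.finiteDimensional hint
  have : IsCyclotomicExtension {N} ℚ ℚ⟮ξ⟯ := by
    change IsCyclotomicExtension {N} ℚ (ℚ⟮ξ⟯).toSubalgebra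
    rw [adjoin_simple_toSubalgebra_of_isAlgebraic hint.isAlgebraic]
    exact hξ.adjoin_isCyclotomicExtension ℚ
  have : IsGalois ℚ ℚ⟮ξ⟯ := IsCyclotomicExtension.isGalois {N} ℚ ℚ⟮ξ⟯
  -- The two `ℚ`-algebra structures agree only propositionally.
  have : @IsGalois ℚ _ ℚ⟮ξ⟯ _ (ℚ⟮ξ⟯).algebra' := by
    convert this
    exact Subsingleton.elim _ _
  have hd : (ℚ⟮ξ⟯).LinearDisjoint F := LinearDisjoint.of_inf_eq_bot (by rwa [inf_comm])
  have hli := hd.linearIndependent_left (adjoin.powerBasis hint).basis.linearIndependent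
  have : FiniteDimensional F F⟮ξ⟯ := adjoin.finiteDimensional hintF
  have hli' : LinearIndependent F
      (fun i : Fin (adjoin.powerBasis hint).dim => AdjoinSimple.gen F ξ ^ (i : ℕ)) := by
    refine LinearIndependent.of_comp (F⟮ξ⟯).val.toLinearMap ?_
    convert hli using 1
    ext i
    simp
  have hcard := hli'.fintype_card_le_finrank
  rw [Fintype.card_fin, adjoin.finrank hintF, adjoin.powerBasis_dim,
    ← Polynomial.cyclotomic_eq_minpoly_rat hξ (NeZero.pos N), Polynomial.natDegree_cyclotomic]
    at hcard
  refine (Polynomial.eq_of_monic_of_dvd_of_natDegree_le (minpoly.monic hintF)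
    (Polynomial.cyclotomic.monic N F) (minpoly.dvd _ _ ?_) ?_).symm
  · rw [Polynomial.aeval_def, ← Polynomial.eval_map, Polynomial.map_cyclotomic]
    exact (hξ.isRoot_cyclotomic (NeZero.pos N))
  · rwa [Polynomial.natDegree_cyclotomic]

open IntermediateField in
lemma IsPrimitiveRoot.exists_algHom_gen_eq_pow (F : IntermediateField ℚ ℂ)
    [FiniteDimensional ℚ F] {N : ℕ} [NeZero N] {ξ : ℂ} (hξ : IsPrimitiveRoot ξ N)
    (h : F ⊓ ℚ⟮ξ⟯ = ⊥) {b : ℕ} (hb : b.Coprime N) :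
    ∃ σ : F⟮ξ⟯ →ₐ[F] ℂ, σ (AdjoinSimple.gen F ξ) = ξ ^ b := by
  have hint : IsIntegral F ξ := (hξ.isIntegral (NeZero.pos N)).tower_top
  refine ⟨(adjoin.powerBasis hint).lift (ξ ^ b) ?_, ?_⟩
  · rw [adjoin.powerBasis_gen, minpoly_gen, hξ.minpoly_eq_cyclotomic_of_inf_eq_bot F h,
      Polynomial.aeval_def, ← Polynomial.eval_map, Polynomial.map_cyclotomic]
    exact ((hξ.pow_of_coprime b hb).isRoot_cyclotomic (NeZero.pos N))
  · exact (adjoin.powerBasis hint).lift_gen _ _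

open IntermediateField in
lemma ZMod.sum_mul_cotChar_smul_eq_zero {ℓ : ℕ} {q : Fin ℓ → ℕ} [∀ j, NeZero (q j)]
    (hcop : Pairwise fun i j => Nat.Coprime (q i) (q j)) (F : IntermediateField ℚ ℂ)
    [FiniteDimensional ℚ F] {ξ : ℂ} (hξ : IsPrimitiveRoot ξ (∏ j, q j))
    (hF : F ⊓ ℚ⟮ξ⟯ = ⊥) {ι : Type*} (s : Finset ι) (c : ι → ℂ) (hc : ∀ i ∈ s, c i ∈ F)
    (j : ι → Fin ℓ) (x : ∀ i, ZMod (q (j i)))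
    (hsum : ∑ i ∈ s, c i * cotChar (x i) = 0) (u : ∀ j, (ZMod (q j))ˣ) :
    ∑ i ∈ s, c i * cotChar ((u (j i) : ZMod (q (j i))) * x i) = 0 := by
  classical
  have hN : NeZero (∏ j, q j) := ⟨Finset.prod_ne_zero_iff.2 fun j _ => NeZero.ne _⟩
  have hdvd (i : Fin ℓ) : q i ∣ ∏ j, q j := Finset.dvd_prod_of_mem q (Finset.mem_univ i)
  obtain ⟨U, hU⟩ := (Units.mapEquiv (ZMod.prodEquivPi q hcop).toMulEquiv).surjective
    (MulEquiv.piUnits.symm u)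
  have hUu (i : Fin ℓ) : (((U : ZMod (∏ j, q j)).val : ℕ) : ZMod (q i)) = u i := by
    have h := congrFun (congrArg Units.val hU) i
    rw [ZMod.natCast_val, ← ZMod.castHom_apply (h := hdvd i) (R := ZMod (q i)),
      ← ZMod.prodEquivPi_apply q hcop]
    exact h
  set b := (U : ZMod (∏ j, q j)).val with hb
  obtain ⟨σ, hσ⟩ := hξ.exists_algHom_gen_eq_pow F hF (ZMod.val_coe_unit_coprime U)
  have hpow (i : ι) : ∃ k : ℕ, ξ ^ k = stdAddChar (x i) := by
    obtain ⟨k, -, hk⟩ := hξ.eq_pow_of_pow_eq_one (ξ := stdAddChar (x i)) (by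
      obtain ⟨d, hd⟩ := hdvd (j i)
      rw [← AddChar.map_nsmul_eq_pow, hd, mul_nsmul]
      simp)
    exact ⟨k, hk⟩
  choose k hk using hpow
  set g := AdjoinSimple.gen F ξ
  have hval (y : F⟮ξ⟯) (hy : (y : ℂ) = 0) : σ y = 0 := by
    rw [show y = 0 from Subtype.ext hy, map_zero]
  have key := hval (∑ i ∈ s.attach, algebraMap F F⟮ξ⟯ ⟨c i, hc i i.2⟩ *
    ((g ^ k i + 1) / (g ^ k i - 1))) (by
      rw [← hsum, ← Finset.sum_attach s]
      push_cast
      refine Finset.sum_congr rfl fun i _ => ?_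
      rw [cotChar, ← hk]
      rfl)
  rw [map_sum] at key
  rw [← Finset.sum_attach s, ← key]
  refine Finset.sum_congr rfl fun i _ => ?_
  have hstd : stdAddChar ((u (j i) : ZMod (q (j i))) * x i) = (ξ ^ b) ^ k i := by
    rw [← hUu, ← nsmul_eq_mul, AddChar.map_nsmul_eq_pow, ← hk, pow_right_comm]
  -- `map_div₀` also covers zero denominators, so `x i = 0` needs no separate case.
  rw [map_mul, map_div₀, map_add, map_sub, map_pow, hσ, map_one, AlgHom.commutes, cotChar, hstd]
  rfl


/-! ### Independence of the cotangents -/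

lemma DirichletCharacter.sum_mul_cotChar_smul {N : ℕ} [NeZero N] (χ : DirichletCharacter ℂ N)
    (u : (ZMod N)ˣ) : ∑ x : ZMod N, χ x * ZMod.cotChar ((u : ZMod N) * x) =
      χ (u : ZMod N)⁻¹ * ∑ x : ZMod N, χ x * ZMod.cotChar x := by
  rw [Finset.mul_sum, ← Equiv.sum_comp (Units.mulLeft u)
    fun x => χ (u : ZMod N)⁻¹ * (χ x * ZMod.cotChar x)]
  refine Finset.sum_congr rfl fun x _ => ?_
  rw [Units.mulLeft_apply, ← mul_assoc, ← map_mul, ← mul_assoc, ZMod.inv_coe_unit, Units.inv_mul,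
    one_mul]

lemma ZMod.eq_zero_of_sum_mul_cotChar_smul_eq_zero {N : ℕ} [NeZero N] {ι : Type*} [Fintype ι]
    {x : ι → (ZMod N)ˣ} (hinj : Function.Injective x) (hneg : ∀ i k, x i ≠ -x k) {r : ι → ℂ}
    (h : ∀ v : (ZMod N)ˣ, ∑ i, r i * cotChar ((v : ZMod N) * (x i : ZMod N)) = 0) (k : ι) : r k = 0 := by
  classical
  have h1 (χ : DirichletCharacter ℂ N) (hχ : χ.Odd) :
      ∑ i, r i * χ (x i : ZMod N)⁻¹ = 0 := by
    refine (mul_eq_zero.1 ?_).resolve_right hχ.sum_mul_cotChar_ne_zero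
    have h2 (z : ZMod N) : χ z * ∑ i, r i * cotChar (z * (x i : ZMod N)) = 0 := by
      by_cases hz : IsUnit z
      · obtain ⟨v, rfl⟩ := hz
        rw [h v, mul_zero]
      · rw [χ.map_nonunit hz, zero_mul]
    have h3 := Finset.sum_eq_zero (s := Finset.univ) fun z _ => h2 z
    simp_rw [Finset.mul_sum] at h3
    rw [Finset.sum_comm] at h3
    rw [Finset.sum_mul, ← h3]
    refine Finset.sum_congr rfl fun i _ => ?_
    rw [mul_assoc, ← DirichletCharacter.sum_mul_cotChar_smul, Finset.mul_sum]
    refine Finset.sum_congr rfl fun z _ => ?_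
    rw [mul_comm z]
    ring
  -- The factor `χ(x_k) - χ(-x_k)` kills even characters, so orthogonality over all characters
  -- applies.
  have h2 (χ : DirichletCharacter ℂ N) :
      ∑ i, r i * (χ (x i : ZMod N)⁻¹ * χ (x k) - χ (x i : ZMod N)⁻¹ * χ (-x k)) = 0 := by
    have : ∑ i, r i * (χ (x i : ZMod N)⁻¹ * χ (x k) - χ (x i : ZMod N)⁻¹ * χ (-x k)) =
        (∑ i, r i * χ (x i : ZMod N)⁻¹) * (χ (x k) - χ (-x k)) := by
      rw [Finset.sum_mul]
      exact Finset.sum_congr rfl fun i _ => by ring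
    rw [this]
    rcases χ.even_or_odd with hχ | hχ
    · rw [hχ.eval_neg, sub_self, mul_zero]
    · rw [h1 χ hχ, zero_mul]
  have h3 := Finset.sum_eq_zero (s := Finset.univ) fun χ _ => h2 χ
  rw [Finset.sum_comm] at h3
  simp_rw [← Finset.mul_sum, Finset.sum_sub_distrib,
    DirichletCharacter.sum_char_inv_mul_char_eq ℂ (Units.isUnit _)] at h3
  have h4 (i : ι) : (x i : ZMod N) ≠ -(x k : ZMod N) := fun h => hneg i k (Units.ext h)
  simp only [h4, if_false, sub_zero, Units.val_inj, hinj.eq_iff, mul_ite, mul_zero,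
    Finset.sum_ite_eq', Finset.mem_univ, if_true] at h3
  refine (mul_eq_zero.1 h3).resolve_right ?_
  exact_mod_cast (Nat.totient_pos.2 (NeZero.pos N)).ne'

open IntermediateField in
lemma Real.linearIndependent_cot {ℓ : ℕ} {q : Fin ℓ → ℕ} [∀ j, NeZero (q j)]
    (hcop : Pairwise fun i j => Nat.Coprime (q i) (q j)) :
    LinearIndependent ℚ
      (fun x : (j : Fin ℓ) × {a : ℕ // 1 ≤ a ∧ (a : ℝ) < (q j : ℝ) / 2 ∧ Nat.Coprime a (q j)} =>
        Real.cot (Real.pi * (x.2.1 : ℝ) / (q x.1 : ℝ))) := by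
  classical
  have hlt (j : Fin ℓ)
      (a : {a : ℕ // 1 ≤ a ∧ (a : ℝ) < (q j : ℝ) / 2 ∧ Nat.Coprime a (q j)}) : 2 * a.1 < q j := by
    have := a.2.2.1
    rw [lt_div_iff₀ two_pos] at this
    rw [mul_comm]
    exact_mod_cast this
  have hfin (j : Fin ℓ) :
      Finite {a : ℕ // 1 ≤ a ∧ (a : ℝ) < (q j : ℝ) / 2 ∧ Nat.Coprime a (q j)} :=
    Finite.of_injective (β := Fin (q j)) (fun a => ⟨a.1, by have := hlt j a; omega⟩)
      fun a b hab => Subtype.ext (by simpa using hab)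
  have (j : Fin ℓ) := Fintype.ofFinite
    {a : ℕ // 1 ≤ a ∧ (a : ℝ) < (q j : ℝ) / 2 ∧ Nat.Coprime a (q j)}
  rw [Fintype.linearIndependent_iff]
  intro r hr
  have hsum : ∑ i, (r i : ℂ) * ZMod.cotChar ((i.2.1 : ℕ) : ZMod (q i.1)) = 0 := by
    have h := congrArg (fun t : ℝ => -Complex.I * (t : ℂ)) hr
    simp only [Complex.ofReal_zero, mul_zero] at h
    rw [← h, Complex.ofReal_sum, Finset.mul_sum]
    refine Finset.sum_congr rfl fun i _ => ?_
    rw [ZMod.cotChar_natCast, Rat.smul_def, mul_div_assoc]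
    push_cast
    ring
  have hgal := ZMod.sum_mul_cotChar_smul_eq_zero hcop (⊥ : IntermediateField ℚ ℂ)
    (Complex.isPrimitiveRoot_exp _ (Finset.prod_ne_zero_iff.2 fun j _ => NeZero.ne (q j)))
    (bot_inf_eq _) Finset.univ (fun i => (r i : ℂ)) (fun i _ => ⟨r i, by simp⟩) (fun i => i.1)
    (fun i => ((i.2.1 : ℕ) : ZMod (q i.1))) hsum
  rintro ⟨j, a⟩
  have hj (v : (ZMod (q j))ˣ) :
      ∑ a, (r ⟨j, a⟩ : ℂ) * ZMod.cotChar ((v : ZMod (q j)) * ((a.1 : ℕ) : ZMod (q j))) = 0 := by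
    -- Twists by `v` and `-v` at `j` alone: subtracting cancels the other moduli and, by oddness,
    -- doubles the terms at `j`.
    have h1 := hgal (Function.update 1 j v)
    have h2 := hgal (Function.update 1 j (-v))
    rw [Fintype.sum_sigma] at h1 h2
    have h3 := congrArg₂ (· - ·) h1 h2
    simp only [sub_zero] at h3
    rw [← Finset.sum_sub_distrib, Finset.sum_eq_single j] at h3
    · simp only [Function.update_self, Units.val_neg, neg_mul, ZMod.cotChar_neg, mul_neg,
        Finset.sum_neg_distrib, sub_neg_eq_add] at h3
      exact add_self_eq_zero.1 h3
    · intro i _ hij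
      simp [Function.update_of_ne hij]
    · simp
  have key := ZMod.eq_zero_of_sum_mul_cotChar_smul_eq_zero (N := q j)
    (x := fun a : {a : ℕ // 1 ≤ a ∧ (a : ℝ) < (q j : ℝ) / 2 ∧ Nat.Coprime a (q j)} =>
      ZMod.unitOfCoprime a.1 a.2.2.2) (r := fun a => (r ⟨j, a⟩ : ℂ)) ?_ ?_
      (by simpa only [ZMod.coe_unitOfCoprime] using hj) a
  · exact_mod_cast key
  · intro a b hab
    have h := congrArg Units.val hab
    simp only [ZMod.coe_unitOfCoprime] at h
    rw [ZMod.natCast_eq_natCast_iff', Nat.mod_eq_of_lt (by have := hlt j a; omega),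
      Nat.mod_eq_of_lt (by have := hlt j b; omega)] at h
    exact Subtype.ext h
  · intro a b hab
    have h := congrArg Units.val hab
    simp only [ZMod.coe_unitOfCoprime, Units.val_neg] at h
    rw [eq_neg_iff_add_eq_zero, ← Nat.cast_add, ZMod.natCast_eq_zero_iff] at h
    have h1 := Nat.le_of_dvd (by have := a.2.1; omega) h
    have h2 := hlt j a
    have h3 := hlt j b
    omega

/-! ### Independence of the `L`-values -/

/-- The character of `∏ j, (ZMod (q j))ˣ` induced by a Dirichlet character modulo one `q j`. -/
noncomputable def DirichletCharacter.piUnitsHom {ι : Type*} {q : ι → ℕ} (j : ι)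
    (χ : DirichletCharacter ℂ (q j)) : (∀ j, (ZMod (q j))ˣ) →* ℂ :=
  (χ.toMonoidHom.comp (Units.coeHom _)).comp (Pi.evalMonoidHom (fun j => (ZMod (q j))ˣ) j)

lemma DirichletCharacter.piUnitsHom_apply {ι : Type*} {q : ι → ℕ} (j : ι)
    (χ : DirichletCharacter ℂ (q j)) (u : ∀ j, (ZMod (q j))ˣ) : χ.piUnitsHom j u = χ (u j) := rfl

/-- Oddness separates different moduli: the tuple with `-1` at `j` and `1` elsewhere is sent to `-1`
only by characters from `j`. -/
lemma DirichletCharacter.injective_piUnitsHom_odd {ι : Type*} (q : ι → ℕ) :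
    Function.Injective fun i : (j : ι) × {χ : DirichletCharacter ℂ (q j) // χ.Odd} =>
      piUnitsHom i.1 i.2.1 := by
  classical
  rintro ⟨j, χ, hχ⟩ ⟨k, ψ, hψ⟩ h
  rcases eq_or_ne j k with rfl | hjk
  · suffices χ = ψ by subst this; rfl
    refine MulChar.ext fun v => ?_
    simpa [piUnitsHom_apply] using DFunLike.congr_fun h (Pi.mulSingle j v)
  · have h1 := DFunLike.congr_fun h (Pi.mulSingle j (-1))
    have h2 : χ (-1) = -1 := hχ
    simp [piUnitsHom_apply, Pi.mulSingle_eq_of_ne hjk.symm, h2] at h1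
    norm_num at h1

lemma DirichletCharacter.eq_zero_of_forall_sum_mul_odd_eq_zero {ι : Type*} {q : ι → ℕ}
    [Fintype ((j : ι) × {χ : DirichletCharacter ℂ (q j) // χ.Odd})]
    {a : (j : ι) × {χ : DirichletCharacter ℂ (q j) // χ.Odd} → ℂ}
    (h : ∀ u : ∀ j, (ZMod (q j))ˣ, ∑ i, a i * i.2.1 (u i.1) = 0)
    (i : (j : ι) × {χ : DirichletCharacter ℂ (q j) // χ.Odd}) : a i = 0 := by
  have hli := (linearIndependent_monoidHom (∀ j, (ZMod (q j))ˣ) ℂ).comp _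
    (injective_piUnitsHom_odd q)
  refine Fintype.linearIndependent_iff.1 hli a ?_ i
  ext u
  rw [Finset.sum_apply, Pi.zero_apply, ← h u]
  rfl

lemma DirichletCharacter.exists_pow_eq_of_isPrimitiveRoot {N M : ℕ} [NeZero N] [NeZero M] {ζ : ℂ}
    (hζ : IsPrimitiveRoot ζ M) (hM : N.totient ∣ M) (χ : DirichletCharacter ℂ N)
    (u : (ZMod N)ˣ) : ∃ k : ℕ, ζ ^ k = χ u := by
  obtain ⟨k, -, hk⟩ := hζ.eq_pow_of_pow_eq_one (ξ := χ u) (by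
    obtain ⟨d, rfl⟩ := hM
    rw [← map_pow, ← Units.val_pow_eq_pow_val, pow_mul, ZMod.pow_totient, one_pow, Units.val_one,
      map_one])
  exact ⟨k, hk⟩

open IntermediateField in
lemma ZMod.sum_sum_mul_cotChar_smul_eq_zero {ℓ : ℕ} {q : Fin ℓ → ℕ} [∀ j, NeZero (q j)]
    (hcop : Pairwise fun i j => Nat.Coprime (q i) (q j)) (F : IntermediateField ℚ ℂ)
    [FiniteDimensional ℚ F] {ξ : ℂ} (hξ : IsPrimitiveRoot ξ (∏ j, q j))
    (hF : F ⊓ ℚ⟮ξ⟯ = ⊥) {ι : Type*} [Fintype ι] (j : ι → Fin ℓ) (c : ∀ i, ZMod (q (j i)) → ℂ)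
    (hc : ∀ i x, c i x ∈ F) (hsum : ∑ i, ∑ x, c i x * cotChar x = 0) (u : ∀ j, (ZMod (q j))ˣ) :
    ∑ i, ∑ x, c i x * cotChar ((u (j i) : ZMod (q (j i))) * x) = 0 := by
  rw [← Fintype.sum_sigma'] at hsum ⊢
  exact sum_mul_cotChar_smul_eq_zero hcop F hξ hF Finset.univ
    (fun i : (i : ι) × ZMod (q (j i)) => c i.1 i.2) (fun i _ => hc i.1 i.2) (fun i => j i.1)
    (fun i => i.2) hsum u

open IntermediateField in
lemma DirichletCharacter.eq_zero_of_sum_mul_LFunction_one_eq_zero {ℓ : ℕ} {q : Fin ℓ → ℕ}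
    [∀ j, NeZero (q j)] (hcop : Pairwise fun i j => Nat.Coprime (q i) (q j))
    (F : IntermediateField ℚ ℂ) [FiniteDimensional ℚ F] {ζ ξ : ℂ}
    (hζ : IsPrimitiveRoot ζ (∏ j, Nat.totient (q j))) (hξ : IsPrimitiveRoot ξ (∏ j, q j))
    (hζF : ζ ∈ F) (hF : F ⊓ ℚ⟮ξ⟯ = ⊥)
    [Fintype ((j : Fin ℓ) × {χ : DirichletCharacter ℂ (q j) // χ.Odd})]
    (c : (j : Fin ℓ) × {χ : DirichletCharacter ℂ (q j) // χ.Odd} → ℂ) (hc : ∀ i, c i ∈ F)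
    (hsum : ∑ i, c i * i.2.1.LFunction 1 = 0)
    (i : (j : Fin ℓ) × {χ : DirichletCharacter ℂ (q j) // χ.Odd}) : c i = 0 := by
  have hM : NeZero (∏ j, Nat.totient (q j)) :=
    ⟨Finset.prod_ne_zero_iff.2 fun j _ => (Nat.totient_pos.2 (NeZero.pos (q j))).ne'⟩
  have hχF (j : Fin ℓ) (χ : DirichletCharacter ℂ (q j)) (x : ZMod (q j)) : χ x ∈ F := by
    by_cases hx : IsUnit x
    · obtain ⟨u, rfl⟩ := hx
      obtain ⟨k, hk⟩ := χ.exists_pow_eq_of_isPrimitiveRoot hζ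
        (Finset.dvd_prod_of_mem (fun j => Nat.totient (q j)) (Finset.mem_univ j)) u
      exact hk ▸ pow_mem hζF k
    · rw [χ.map_nonunit hx]
      exact zero_mem F
  set y := fun i : (j : Fin ℓ) × {χ : DirichletCharacter ℂ (q j) // χ.Odd} =>
    ∑ x : ZMod (q i.1), i.2.1 x * ZMod.cotChar x with hy
  have hq (j : Fin ℓ) : (q j : ℂ) ≠ 0 := NeZero.ne _
  have hsum' : ∑ i : (j : Fin ℓ) × {χ : DirichletCharacter ℂ (q j) // χ.Odd},
      ∑ x : ZMod (q i.1), (c i / q i.1 * i.2.1 x) * ZMod.cotChar x = 0 := by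
    have h0 : Complex.I * Real.pi / 2 ≠ 0 := by simp [Real.pi_ne_zero]
    refine (mul_eq_zero.1 ?_).resolve_left h0
    rw [← hsum, Finset.mul_sum]
    refine Finset.sum_congr rfl fun i _ => ?_
    rw [i.2.2.LFunction_one, ← mul_assoc, Finset.mul_sum, Finset.mul_sum]
    refine Finset.sum_congr rfl fun x _ => ?_
    have := hq i.1
    field_simp
  have hgal := ZMod.sum_sum_mul_cotChar_smul_eq_zero hcop F hξ hF Sigma.fst
    (fun i x => c i / q i.1 * i.2.1 x)
    (fun i x => mul_mem (div_mem (hc i) (_root_.natCast_mem F _)) (hχF _ _ _)) hsum'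
  -- Twisting by `u⁻¹` makes the factor `χ(u)` rather than `χ(u)⁻¹`.
  have h := eq_zero_of_forall_sum_mul_odd_eq_zero (a := fun i => c i / q i.1 * y i) (fun u => by
    rw [← hgal u⁻¹]
    refine Finset.sum_congr rfl fun i _ => ?_
    simp only [mul_assoc, ← Finset.mul_sum, Pi.inv_apply]
    rw [DirichletCharacter.sum_mul_cotChar_smul, ZMod.inv_coe_unit, inv_inv, mul_comm (y i)]) i
  have := (mul_eq_zero.1 h).resolve_right i.2.2.sum_mul_cotChar_ne_zero
  exact (div_eq_zero_iff.1 this).resolve_right (hq _)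

theorem theorem4 (ℓ : ℕ) (q : Fin ℓ → ℕ) [∀ j, NeZero (q j)]
    (hq : ∀ j, 2 < q j) (hcop : Pairwise fun i j => Nat.Coprime (q i) (q j)) :
    LinearIndependent ℚ
      (fun x : (j : Fin ℓ) × {a : ℕ // 1 ≤ a ∧ (a : ℝ) < (q j : ℝ) / 2 ∧ Nat.Coprime a (q j)} =>
        Real.cot (Real.pi * (x.2.1 : ℝ) / (q x.1 : ℝ))) ∧
    ∀ (K : IntermediateField ℚ ℂ) [NumberField K] (ζ ξ : ℂ),
      IsPrimitiveRoot ζ (∏ j, Nat.totient (q j)) →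
      IsPrimitiveRoot ξ (∏ j, q j) →
      (IntermediateField.adjoin K {ζ}).restrictScalars ℚ ⊓ IntermediateField.adjoin ℚ {ξ} = ⊥ →
      LinearIndependent (IntermediateField.adjoin K {ζ})
        (fun x : (j : Fin ℓ) × {χ : DirichletCharacter ℂ (q j) // χ.Odd} =>
          DirichletCharacter.LFunction x.2.1 1) := by
  refine ⟨Real.linearIndependent_cot hcop, fun K _ ζ ξ hζ hξ hF => ?_⟩
  have hint : IsIntegral K ζ := (hζ.isIntegral (Finset.prod_pos fun j _ =>
    Nat.totient_pos.2 (NeZero.pos (q j)))).tower_top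
  have : FiniteDimensional K (IntermediateField.adjoin K {ζ}) :=
    IntermediateField.adjoin.finiteDimensional hint
  have : FiniteDimensional ℚ ((IntermediateField.adjoin K {ζ}).restrictScalars ℚ) :=
    Module.Finite.trans (R := ℚ) K (IntermediateField.adjoin K {ζ})
  have := Fintype.ofFinite ((j : Fin ℓ) × {χ : DirichletCharacter ℂ (q j) // χ.Odd})
  rw [Fintype.linearIndependent_iff]
  intro c hc i
  exact Subtype.ext (DirichletCharacter.eq_zero_of_sum_mul_LFunction_one_eq_zero hcop
    ((IntermediateField.adjoin K {ζ}).restrictScalars ℚ) hζ hξ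
    (IntermediateField.mem_adjoin_simple_self K ζ) hF (fun i => (c i : ℂ)) (fun i => (c i).2) hc i)
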